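/- Let $G$ be a finite connected simple graph with vertex set $V$, $|V|>1$, and symmetric edge weights $w_{xy}>0$ for $x\sim y$; put $p_{xy}=w_{xy}/\sum_{z\sim x}w_{xz}$. Let $\mathcal C$ be the finite set of unbased oriented cycles of $G$: cyclic sequences of at least two distinct nodes, consecutive ones (cyclically) being adjacent, so that backtracks $(x,y,x)$ are included. Let $\alpha:\mathcal C\to[0,1]$ satisfy $\alpha(c)>0$ for at least one $c$. Let $\mathcal D$ be the set of all $\mathbf u=(v,b)$ with $v_x$ a neighbour of $x$ for each $x\in V$ and $b_c\in\{0,1\}$ for each $c\in\mathcal C$. Under the product law $\mathbb P_{\mathbf U}$ on $\mathcal D$ all the variables are independent, $v_x=y$ with probability $p_{xy}$, and $b_c=1$ with probability $\alpha(c)$. The constraint $\varphi_c$ is violated by $\mathbf u$ if $b_c=0$ and $v_x$ is the successor of $x$ in $c$ for every node $x$ of $c$. The scope of $\varphi_c$ consists of the variables $v_x$, $x\in c$, and $b_c$. Write $\Phi(\mathbf u)$ if $\mathbf u$ violates no constraint. Fix a total order $\sigma$ on $\mathcal C$. Let $(\mathbf E^k)_{k\ge0}$ be the Markov chain on $\mathcal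 D$ with $\mathbf E^0\sim\mathbb P_{\mathbf U}$ which, from a state that violates some constraint, resamples independently (with their original laws) the variables in the scope of the $\sigma$-first violated constraint and keeps the others, and which stays put at the states satisfying $\Phi$. Let $N=\min\{k:\Phi(\mathbf E^k)\}$. A piece is the restriction of some $\mathbf e\in\mathcal D$ to the scope of a constraint $\varphi_c$ that $\mathbf e$ violates; its weight $w(\pi)$ is the product of the probabilities of the values that it holds. A heap is a word in the pieces, up to exchanging consecutive pieces with disjoint scopes. For a heap $H$ let $w(H)=\prod_{\pi\in H}w(\pi)$, with multiplicities, and let $\sharp_c(H)$ be the number of pieces of $H$ attached to $\varphi_c$. A trivial heap is a set $T$ of pieces with pairwise disjoint scopes (the empty set included), and $w(T)=\prod_{\pi\in T}w(\pi)$. Let $\mathcal H$ be the heap obtained by stacking successively, for $j=0,\dots,N-1$, the restriction of $\mathbf E^j$ to the scope that is resampled at that step, and let $U^\star=\mathbf E^N$ be the output. Then $N<\infty$ almost surely, the pair $(\mathcal H,U^\star)$ has the law $$\mathbb P\big((\mathcal H,U^\star)=(H,\mathbf u)\big)=w(H)\,\mathbb P_{\mathbf U}(\mathbf u)\qquad\text{for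 every heap }H\text{ and every }\mathbf u\in\mathcal D\text{ with }\Phi(\mathbf u),$$ and for all $t=(t_c)_{c\in\mathcal C}\in(0,1)^{\mathcal C}$ $$\mathbb E\Big[\prod_{c\in\mathcal C}t_c^{\sharp_c(\mathcal H)}\Big]=\frac{\sum_{T\text{ trivial}}(-1)^{|T|}\,w(T)}{\sum_{T\text{ trivial}}(-1)^{|T|}\,w(T)\prod_{c\in T}t_c},$$ where $c\in T$ means that $T$ has a piece attached to $\varphi_c$, and where the denominator is positive. -/

import Mathlib

open MeasureTheory

universe u

/-! ## Conjunctions of constraints on independent variables -/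

/-- Data of a finite conjunction `Φ = ⋀_{ℓ : L} φ_ℓ` of constraints on independent discrete
variables `(U_i)_{i : ι}`, with `U_i` valued in `X i`. -/
structure ConstraintSystem (ι L : Type*) (X : ι → Type*) where
  /-- `prob i x` is the probability that `U_i = x`. -/
  prob : ∀ i, X i → ℝ
  /-- `scope ℓ` is the set of (indices of) variables on which `φ_ℓ` depends. -/
  scope : L → Finset ι
  /-- `Sat ℓ u` says that the assignment `u` satisfies `φ_ℓ`. -/
  Sat : L → (∀ i, X i) → Prop

namespace ConstraintSystem

variable {ι L : Type*} {X : ι → Type*} (S : ConstraintSystem ι L X)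

/-- The conjunction `Φ`. -/
def Formula (u : ∀ i, X i) : Prop := ∀ ℓ, S.Sat ℓ u

/-- The product law of all the variables. -/
def prodProb [Fintype ι] (u : ∀ i, X i) : ℝ := ∏ i, S.prob i (u i)

open Classical in
/-- The set of violated constraints. -/
noncomputable def bad [Fintype L] (u : ∀ i, X i) : Finset L :=
  Finset.univ.filter fun ℓ => ¬ S.Sat ℓ u

/-- The violated constraint that comes first in the order given by `σ`. -/
noncomputable def first [Fintype L] (σ : L → ℕ) (u : ∀ i, X i) (h : (S.bad u).Nonempty) : L :=
  ((S.bad u).exists_min_image σ h).choose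

open Classical in
/-- Transition probabilities: as long as some constraint is violated, all the variables in the
scope of the first violated constraint are resampled independently, and the other variables are
kept; an assignment that satisfies all the constraints is not changed any more. -/
noncomputable def transition [Fintype L] (σ : L → ℕ) (u u' : ∀ i, X i) : ℝ :=
  if h : (S.bad u).Nonempty then
    if ∀ i, i ∉ S.scope (S.first σ u h) → u' i = u i then
      ∏ i ∈ S.scope (S.first σ u h), S.prob i (u' i)
    else 0
  else if u' = u then 1 else 0

/-- `(E_k)_{k ≥ 0}` is a Markov chain under `P` whose initial law is the product law and whose
transition probabilities are those of partial rejection sampling with the order `σ`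
(finite-dimensional distributions). -/
structure IsPRSChain [Fintype ι] [Fintype L] (σ : L → ℕ) {Ω : Type*} [MeasurableSpace Ω]
    (P : Measure Ω) (E : ℕ → Ω → ∀ i, X i) : Prop where
  measurableSet_eq : ∀ k u, MeasurableSet {ω | E k ω = u}
  path_law : ∀ (k : ℕ) (e : ℕ → ∀ i, X i),
    P.real {ω | ∀ j ≤ k, E j ω = e j} =
      S.prodProb (e 0) * ∏ j ∈ Finset.range k, S.transition σ (e j) (e (j + 1))

/-! ### Heaps of violated constraints -/

/-- A piece: an index `ℓ` with the restriction, to the scope of `φ_ℓ`, of an assignment that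
violates `φ_ℓ`. -/
def Piece : Type _ :=
  {π : Σ ℓ : L, (∀ i : S.scope ℓ, X i) //
    ∃ e : ∀ i, X i, ¬ S.Sat π.1 e ∧ (fun i : S.scope π.1 => e i) = π.2}

namespace Piece

variable {S}

/-- The constraint violated by a piece. -/
def index (π : S.Piece) : L := π.1.1

/-- The values of the variables in a piece. -/
def val (π : S.Piece) : ∀ i : S.scope π.index, X i := π.1.2

/-- The weight of a piece: the probability of the values that it holds. -/
noncomputable def weight (π : S.Piece) : ℝ :=
  ∏ i : S.scope π.index, S.prob i (π.val i)

/-- Two pieces are concurrent if their scopes intersect. -/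
def Concurrent (π π' : S.Piece) : Prop :=
  ¬ Disjoint (S.scope π.index) (S.scope π'.index)

end Piece

noncomputable instance [Finite L] [∀ i, Finite (X i)] : Fintype S.Piece :=
  haveI : Finite S.Piece := inferInstanceAs (Finite {π : Σ ℓ : L, (∀ i : S.scope ℓ, X i) //
    ∃ e : ∀ i, X i, ¬ S.Sat π.1 e ∧ (fun i : S.scope π.1 => e i) = π.2})
  Fintype.ofFinite _

/-- The commutation relations `π π' = π' π` for non-concurrent pieces. -/
def HeapRel (a b : FreeMonoid S.Piece) : Prop :=
  ∃ π π' : S.Piece, ¬ π.Concurrent π' ∧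
    a = FreeMonoid.of π * FreeMonoid.of π' ∧ b = FreeMonoid.of π' * FreeMonoid.of π

/-- Heaps of pieces, as the partially commutative monoid of Cartier and Foata: a heap is a word
in the pieces (read from the bottom to the top) up to exchanges of consecutive non-concurrent
pieces. The product `H₁ * H₂` is the superposition of `H₂` on top of `H₁`, and `1` is the empty
heap. -/
abbrev Heap : Type _ := PresentedMonoid S.HeapRel

namespace Heap

variable {S}

/-- The heap with a single piece. -/
def single (π : S.Piece) : S.Heap := PresentedMonoid.of S.HeapRel π

/-- The multiset of the pieces of a heap. -/
def pieces (H : S.Heap) : Multiset S.Piece :=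
  Multiplicative.toAdd <|
    PresentedMonoid.lift (rels := S.HeapRel) (M := Multiplicative (Multiset S.Piece))
      (fun π => Multiplicative.ofAdd {π})
      (by
        rintro a b ⟨π, π', -, rfl, rfl⟩
        simp only [map_mul]
        exact mul_comm _ _)
      H

/-- The weight of a heap: the product of the weights of its pieces. -/
noncomputable def weight (H : S.Heap) : ℝ := (H.pieces.map Piece.weight).prod

open Classical in
/-- The number of pieces of the heap that violate the constraint `ℓ`. -/
noncomputable def count (ℓ : L) (H : S.Heap) : ℕ := (H.pieces.map Piece.index).count ℓ

end Heap

open Classical in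
/-- Trivial heaps: finite sets of pieces with pairwise disjoint scopes. -/
noncomputable def trivialHeaps [Finite L] [∀ i, Finite (X i)] : Finset (Finset S.Piece) :=
  Finset.univ.filter fun T => ∀ π ∈ T, ∀ π' ∈ T, π ≠ π' → ¬ π.Concurrent π'

/-! ### Splitting a path into a heap and an output -/

/-- The piece resampled in the state `u`: the values, in `u`, of the variables in the scope of the
first violated constraint. -/
noncomputable def resampledPiece [Fintype L] (σ : L → ℕ) (u : ∀ i, X i)
    (h : (S.bad u).Nonempty) : S.Piece :=
  ⟨⟨S.first σ u h, fun i => u i⟩, u, by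
    simpa [bad, first] using ((S.bad u).exists_min_image σ h).choose_spec.1, rfl⟩

open Classical in
/-- The one-piece heap resampled in the state `u` (empty if `u` violates no constraint). -/
noncomputable def resampledHeap [Fintype L] (σ : L → ℕ) (u : ∀ i, X i) : S.Heap :=
  if h : (S.bad u).Nonempty then Heap.single (S.resampledPiece σ u h) else 1

/-- The first time at which a path satisfies all the constraints (`0` if there is none). -/
noncomputable def stopTime (e : ℕ → ∀ i, X i) : ℕ := sInf {k | S.Formula (e k)}

/-- The heap of resampled scopes of a path stopped at `stopTime`, the pieces being stacked in the
order of the resamplings, together with the final state of the stopped path. -/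
noncomputable def split [Fintype L] (σ : L → ℕ) (e : ℕ → ∀ i, X i) : S.Heap × (∀ i, X i) :=
  (((List.range (S.stopTime e)).map fun j => S.resampledHeap σ (e j)).prod, e (S.stopTime e))

end ConstraintSystem

/-! ## Cycle popping -/

namespace CyclePopping

variable {V : Type u}

/-- Unbased oriented cycles of a graph, backtracks `(x, y, x)` included: sequences of at least two
distinct nodes, consecutive ones (cyclically) being adjacent, up to rotation. -/
def OrientedCycle (G : SimpleGraph V) : Type u :=
  {c : Cycle V // (c.Nodup ∧ c.Nontrivial) ∧ c.Chain G.Adj}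

instance (G : SimpleGraph V) [Finite V] : Finite (OrientedCycle G) := by
  classical
  have := Fintype.ofFinite V
  exact Finite.of_injective
    (fun c : OrientedCycle G => (⟨c.1, c.2.1⟩ : {s : Cycle V // s.Nodup ∧ s.Nontrivial}))
    fun c d h => Subtype.ext (congrArg (fun s => s.1) h)

noncomputable instance (G : SimpleGraph V) [Finite V] : Fintype (OrientedCycle G) :=
  Fintype.ofFinite _

/-- The variables: one for each node and one for each oriented cycle. -/
abbrev Var (G : SimpleGraph V) : Type u := V ⊕ OrientedCycle G

/-- A node variable is valued in the neighbours of the node, a cycle variable in `{0, 1}`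
(`true` stands for `1`). -/
def Val (G : SimpleGraph V) : Var G → Type u
  | .inl x => G.neighborSet x
  | .inr _ => ULift.{u} Bool

instance (G : SimpleGraph V) [Finite V] : ∀ i, Finite (Val G i)
  | .inl x => inferInstanceAs (Finite (G.neighborSet x))
  | .inr _ => inferInstanceAs (Finite (ULift.{u} Bool))

/-- The out-neighbour of the node `x` in the oriented subgraph `F(v)`. -/
def succ {G : SimpleGraph V} (a : ∀ i, Val G i) (x : V) : V :=
  Subtype.val (p := fun y => y ∈ G.neighborSet x) (a (.inl x))

/-- The acceptance bit of the oriented cycle `c`. -/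
def bit {G : SimpleGraph V} (a : ∀ i, Val G i) (c : OrientedCycle G) : Bool :=
  ULift.down (a (.inr c))

open Classical in
/-- The transition probability `p_{xy} = w_{xy} / deg x` of the random walk. -/
noncomputable def stepProb [Fintype V] (G : SimpleGraph V) (w : V → V → ℝ) (x y : V) : ℝ :=
  w x y / ∑ z ∈ Finset.univ.filter (G.Adj x), w x z

/-- The laws of the variables: `P(V_x = y) = p_{xy}` and `P(C_c = 1) = α c`. -/
noncomputable def varProb [Fintype V] (G : SimpleGraph V) (w : V → V → ℝ)
    (α : OrientedCycle G → ℝ) : ∀ i : Var G, Val G i → ℝ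
  | .inl x, y => stepProb G w x (Subtype.val (p := fun y => y ∈ G.neighborSet x) y)
  | .inr c, b => if ULift.down b = true then α c else 1 - α c

open Classical in
/-- The scope attached to `c`: the variables of the nodes of `c`, and the acceptance bit of `c`. -/
noncomputable def cycleScope [Fintype V] (G : SimpleGraph V) (c : OrientedCycle G) :
    Finset (Var G) :=
  Finset.univ.filter fun
    | .inl x => x ∈ c.1
    | .inr d => d = c

/-- `c ∈ F(v)`: each node of `c` points to its successor in `c`. -/
def Contains {G : SimpleGraph V} (a : ∀ i, Val G i) (c : OrientedCycle G) : Prop :=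
  c.1.Chain fun x y => succ a x = y

/-- The constraint attached to each oriented cycle `c`: `c` is absent from `F(v)`, or it is
present and accepted. -/
noncomputable def system [Fintype V] (G : SimpleGraph V) (w : V → V → ℝ)
    (α : OrientedCycle G → ℝ) : ConstraintSystem (Var G) (OrientedCycle G) (Val G) where
  prob := varProb G w α
  scope := cycleScope G
  Sat c a := ¬ Contains a c ∨ (Contains a c ∧ bit a c = true)

end CyclePopping

/-! The system is extremal: two distinct constraints violated at the same time have disjoint scopes,
because two cycles of a functional graph that share a node coincide (`isExtremal_system`).

Runs can then be read backwards. Let each piece of a heap `H` overwrite the variables of its scope,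
starting from a satisfying `a`; the result `act H a` is the only possible initial state. By
extremality, every constraint violated there is attached to a bottom piece of `H`
(`exists_eq_single_mul_of_not_sat`), so the first violated constraint selects the piece to remove,
and so on. Hence exactly one run has heap `H` and output `a` (`exists_isRun`, `IsRun.unique`). Its
probability telescopes to the weight of `H` times the probability of `a`, by the one-step identity
`prodProb_mul_transition`.

Termination comes from counting mass. The runs give disjoint events, so the heap weights are
summable. Their sum is the inverse of the alternating sum over trivial heaps (Cartier and Foata,
`tsum_multWeight_mul_sum_trivialHeaps`), which by inclusion-exclusion is the probability of `Φ`
(`sum_trivialHeaps_weight`). The events therefore have total probability 1. The same inversion for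
the weights multiplied by `t` gives the generating function. All this needs one satisfying
assignment of positive probability: a functional graph whose only cycle is one that can be accepted
(`exists_contains_unique`). -/

namespace ConstraintSystem

variable {ι L : Type*} {X : ι → Type*} {S : ConstraintSystem ι L X}

namespace Heap

/-! ### Heaps: cancellation and minimal pieces -/

theorem single_mul_comm {π π' : S.Piece} (h : ¬ π.Concurrent π') :
    single π * single π' = single π' * single π :=
  PresentedMonoid.mk_eq_mk_of_rel (rels := S.HeapRel) ⟨π, π', h, rfl, rfl⟩

@[elab_as_elim]
theorem cons_induction {p : S.Heap → Prop} (one : p 1)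
    (mul : ∀ (π : S.Piece) (H : S.Heap), p H → p (single π * H)) (H : S.Heap) : p H := by
  induction H using PresentedMonoid.inductionOn with
  | h a =>
    induction a using FreeMonoid.inductionOn' with
    | one => exact one
    | of_mul π a ih => rw [map_mul]; exact mul π _ ih

@[simp] theorem pieces_one : (1 : S.Heap).pieces = 0 := by
  simp [pieces]

@[simp] theorem pieces_mul (H K : S.Heap) : (H * K).pieces = H.pieces + K.pieces := by
  simp [pieces]

@[simp] theorem pieces_single (π : S.Piece) : (single π).pieces = {π} := rfl

theorem eq_one_of_card_pieces {H : S.Heap} (h : H.pieces.card = 0) : H = 1 := by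
  induction H using cons_induction with
  | one => rfl
  | mul π H _ => simp at h

theorem exists_of_ne_one {H : S.Heap} (h : H ≠ 1) : ∃ π K, H = single π * K := by
  induction H using cons_induction with
  | one => exact absurd rfl h
  | mul π H _ => exact ⟨π, H, rfl⟩

open Classical in
/-- The congruence on words that identifies two words when they represent the same heap and still
do so after the first occurrence of `π` is erased. -/
noncomputable def eraseCon (π : S.Piece) : Con (FreeMonoid S.Piece) where
  r a b := PresentedMonoid.mk S.HeapRel a = PresentedMonoid.mk S.HeapRel b ∧
    (π ∈ a.toList ↔ π ∈ b.toList) ∧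
    PresentedMonoid.mk S.HeapRel (FreeMonoid.ofList (a.toList.erase π)) =
      PresentedMonoid.mk S.HeapRel (FreeMonoid.ofList (b.toList.erase π))
  iseqv := ⟨fun _ => ⟨rfl, Iff.rfl, rfl⟩, fun h => ⟨h.1.symm, h.2.1.symm, h.2.2.symm⟩,
    fun h h' => ⟨h.1.trans h'.1, h.2.1.trans h'.2.1, h.2.2.trans h'.2.2⟩⟩
  mul' := by
    rintro a b c d ⟨h1, h2, h3⟩ ⟨k1, k2, k3⟩
    refine ⟨by rw [map_mul, map_mul, h1, k1], by simp [FreeMonoid.toList_mul, h2, k2], ?_⟩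
    -- In a product, the erased letter lies in the left factor exactly when that factor contains
    -- `π`; this is why the congruence records membership.
    simp only [FreeMonoid.toList_mul, List.erase_append, ← h2]
    split_ifs with h
    · simp only [FreeMonoid.ofList_append, map_mul, h3]
      congr 1
    · simp only [FreeMonoid.ofList_append, map_mul, k3]
      congr 1

/-- Erasing `π` from both sides of an exchange leaves the same letter, or the exchange itself if
neither letter is `π`. Erasure thus descends to heaps. -/
theorem conGen_le_eraseCon (π : S.Piece) : conGen S.HeapRel ≤ eraseCon π := by
  classical
  refine Con.conGen_le.2 ?_
  rintro a b ⟨ρ, ρ', h, rfl, rfl⟩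
  refine ⟨single_mul_comm h, by simp [FreeMonoid.toList_mul, or_comm], ?_⟩
  simp only [FreeMonoid.toList_mul, FreeMonoid.toList_of, List.singleton_append, List.erase_cons]
  by_cases h1 : ρ = π <;> by_cases h2 : ρ' = π
  · simp [h1, h2]
  · simp [h1, h2]
  · simp [h1, h2]
  · simp [h1, h2]
    exact single_mul_comm h

theorem single_mul_left_cancel {π : S.Piece} {H K : S.Heap}
    (h : single π * H = single π * K) : H = K := by
  classical
  obtain ⟨a, rfl⟩ := PresentedMonoid.surjective_mk H
  obtain ⟨b, rfl⟩ := PresentedMonoid.surjective_mk K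
  have := (conGen_le_eraseCon π (PresentedMonoid.mk_eq_mk_iff
    (x := FreeMonoid.of π * a) (y := FreeMonoid.of π * b)|>.1 h)).2.2
  simpa [FreeMonoid.toList_mul] using this

/-- The pieces of a heap that hold the variable `i`, in their order. -/
noncomputable def column (i : ι) : S.Heap →* FreeMonoid S.Piece :=
  open Classical in
  PresentedMonoid.lift (rels := S.HeapRel)
    (fun π => if i ∈ S.scope π.index then FreeMonoid.of π else 1) (by
      rintro a b ⟨π, π', h, rfl, rfl⟩
      have hd : i ∈ S.scope π.index → i ∉ S.scope π'.index :=
        fun hi => Finset.disjoint_left.1 (not_not.1 h : Disjoint _ _) hi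
      by_cases h1 : i ∈ S.scope π.index <;> by_cases h2 : i ∈ S.scope π'.index <;>
        simp_all)

theorem column_single_mul {i : ι} {π : S.Piece} (h : i ∈ S.scope π.index) (H : S.Heap) :
    column i (single π * H) = FreeMonoid.of π * column i H := by
  rw [map_mul]
  congr 1
  exact if_pos h

/-- If the scopes shared a variable, its column would be a word in a free monoid with two different
first letters. -/
theorem not_concurrent_of_mul_eq {π π' : S.Piece} (hne : π ≠ π') {H K : S.Heap}
    (h : single π * H = single π' * K) : ¬ π.Concurrent π' := by
  intro hc
  obtain ⟨i, hi, hi'⟩ := Finset.not_disjoint_iff.1 hc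
  have := congrArg (fun H => (column i H).toList) h
  simp only [column_single_mul hi, column_single_mul hi', FreeMonoid.toList_mul,
    FreeMonoid.toList_of, List.singleton_append, List.cons.injEq] at this
  exact hne this.1

/-- Erase `π` from both sides: the leading `π'` survives, and `M` is `K` with its first `π`, if any,
erased. -/
theorem exists_eq_mul_of_mul_eq {π π' : S.Piece} (hne : π ≠ π') {H K : S.Heap}
    (h : single π * H = single π' * K) : ∃ M, H = single π' * M := by
  classical
  obtain ⟨a, rfl⟩ := PresentedMonoid.surjective_mk H
  obtain ⟨b, rfl⟩ := PresentedMonoid.surjective_mk K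
  have := (conGen_le_eraseCon π (PresentedMonoid.mk_eq_mk_iff
    (x := FreeMonoid.of π * a) (y := FreeMonoid.of π' * b)|>.1 h)).2.2
  simp only [FreeMonoid.toList_mul, FreeMonoid.toList_of, List.singleton_append,
    List.erase_cons, beq_self_eq_true, if_true, beq_iff_eq, hne.symm, if_false,
    FreeMonoid.ofList_toList] at this
  rw [FreeMonoid.ofList_cons, map_mul] at this
  exact ⟨_, this⟩

/-! ### The inversion formula of Cartier and Foata -/

/-- The multiplicative extension to heaps of a function of the pieces. -/
noncomputable def multWeight (g : S.Piece → ℝ) (H : S.Heap) : ℝ := (H.pieces.map g).prod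

theorem multWeight_mul (g : S.Piece → ℝ) (H K : S.Heap) :
    multWeight g (H * K) = multWeight g H * multWeight g K := by
  simp [multWeight]

@[simp] theorem multWeight_one (g : S.Piece → ℝ) : multWeight g 1 = 1 := by
  simp [multWeight]

@[simp] theorem multWeight_single (g : S.Piece → ℝ) (π : S.Piece) :
    multWeight g (single π) = g π := by
  simp [multWeight]

theorem multWeight_list_prod (g : S.Piece → ℝ) (l : List S.Piece) :
    multWeight g (l.map single).prod = (l.map g).prod := by
  induction l with
  | nil => simp
  | cons π l ih => simp [multWeight_mul, ih]

theorem mul_list_prod_comm {π : S.Piece} {l : List S.Piece}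
    (h : ∀ π' ∈ l, ¬ π.Concurrent π') :
    single π * (l.map single).prod = (l.map single).prod * single π := by
  induction l with
  | nil => simp
  | cons ρ l ih =>
    rw [List.map_cons, List.prod_cons, ← mul_assoc, single_mul_comm (h ρ (by simp)), mul_assoc,
      ih fun π' h' => h π' (by simp [h']), mul_assoc]

theorem list_prod_mul_left_cancel (l : List S.Piece) {H K : S.Heap}
    (h : (l.map single).prod * H = (l.map single).prod * K) : H = K := by
  induction l with
  | nil => simpa using h
  | cons ρ l ih =>
    simp only [List.map_cons, List.prod_cons, mul_assoc] at h
    exact ih (single_mul_left_cancel h)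

/-- A heap is a superposition over the trivial heap of the pieces of `l` if and only if all the
pieces of `l` are at its bottom. -/
theorem exists_eq_list_prod_mul_iff {l : List S.Piece} (hl : l.Nodup)
    (hc : ∀ π ∈ l, ∀ π' ∈ l, π ≠ π' → ¬ π.Concurrent π') (K : S.Heap) :
    (∃ H, K = (l.map single).prod * H) ↔ ∀ π ∈ l, ∃ H, K = single π * H := by
  induction l generalizing K with
  | nil => simp
  | cons ρ l ih =>
    obtain ⟨hρ, hl⟩ := List.nodup_cons.1 hl
    have hc' : ∀ π ∈ l, ∀ π' ∈ l, π ≠ π' → ¬ π.Concurrent π' := fun π h π' h' =>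
      hc π (by simp [h]) π' (by simp [h'])
    have hρc : ∀ π ∈ l, ¬ ρ.Concurrent π := fun π h =>
      hc ρ (by simp) π (by simp [h]) (by rintro rfl; exact hρ h)
    constructor
    · rintro ⟨H, rfl⟩ π hπ
      rw [List.map_cons, List.prod_cons]
      rcases List.mem_cons.1 hπ with rfl | hπ
      · exact ⟨_, mul_assoc _ _ _⟩
      · rw [mul_list_prod_comm hρc, mul_assoc]
        exact (ih hl hc' _).1 ⟨_, rfl⟩ π hπ
    · intro h
      obtain ⟨K', rfl⟩ := h ρ (by simp)
      have : ∀ π ∈ l, ∃ H, K' = single π * H := fun π hπ => by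
        obtain ⟨H, hH⟩ := h π (by simp [hπ])
        exact exists_eq_mul_of_mul_eq (by rintro rfl; exact hρ hπ) hH
      obtain ⟨H, rfl⟩ := (ih hl hc' _).2 this
      exact ⟨H, by simp [mul_assoc]⟩

open Classical in
/-- The pieces at the bottom of a heap. -/
noncomputable def bottom [Finite L] [∀ i, Finite (X i)] (K : S.Heap) : Finset S.Piece :=
  Finset.univ.filter fun π => ∃ H, K = single π * H

theorem bottom_eq_empty_iff [Finite L] [∀ i, Finite (X i)] {K : S.Heap} :
    K.bottom = ∅ ↔ K = 1 := by
  classical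
  constructor
  · intro h
    by_contra hK
    obtain ⟨π, H, hH⟩ := exists_of_ne_one hK
    have : π ∈ K.bottom := by simpa [bottom] using ⟨H, hH⟩
    simp [h] at this
  · rintro rfl
    refine Finset.filter_eq_empty_iff.2 ?_
    rintro π - ⟨H, hH⟩
    have := congrArg (fun H => H.pieces.card) hH
    simp at this

-- Bottom pieces are pairwise non-concurrent, so every subset of the bottom is trivial, and the
-- alternating sum over all subsets vanishes unless the bottom is empty.
open Classical in
theorem sum_trivialHeaps_subset_bottom [Finite L] [∀ i, Finite (X i)] (K : S.Heap) :
    (∑ T ∈ S.trivialHeaps, if T ⊆ K.bottom then (-1 : ℝ) ^ T.card else 0) =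
      if K = 1 then 1 else 0 := by
  classical
  rw [← Finset.sum_filter]
  have : S.trivialHeaps.filter (fun T => T ⊆ K.bottom) = K.bottom.powerset := by
    ext T
    simp only [Finset.mem_filter, Finset.mem_powerset, and_iff_right_iff_imp, trivialHeaps,
      Finset.mem_univ, true_and]
    intro hT π hπ π' hπ' hne
    obtain ⟨H, hH⟩ := (Finset.mem_filter.1 (hT hπ)).2
    obtain ⟨H', hH'⟩ := (Finset.mem_filter.1 (hT hπ')).2
    exact not_concurrent_of_mul_eq hne (hH.symm.trans hH')
  rw [this]
  have h := Finset.sum_powerset_neg_one_pow_card (x := K.bottom)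
  have h' := congrArg (Int.cast (R := ℝ)) h
  push_cast at h'
  rw [h']
  simp only [bottom_eq_empty_iff]

-- By cancellation, stacking on top of `T` is a bijection from all heaps onto those whose bottom
-- contains `T`.
open Classical in
theorem tsum_subset_bottom [Finite L] [∀ i, Finite (X i)] (g : S.Piece → ℝ)
    {T : Finset S.Piece} (hT : T ∈ S.trivialHeaps) :
    ∑' K : S.Heap, (if T ⊆ K.bottom then multWeight g K else 0) =
      (∏ π ∈ T, g π) * ∑' H : S.Heap, multWeight g H := by
  classical
  have hT' : ∀ π ∈ T, ∀ π' ∈ T, π ≠ π' → ¬ π.Concurrent π' := (Finset.mem_filter.1 hT).2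
  let f : S.Heap → S.Heap := fun H => (T.toList.map single).prod * H
  have hf : Function.Injective f := fun H K h => list_prod_mul_left_cancel _ h
  have hr : ∀ K : S.Heap, T ⊆ K.bottom ↔ ∃ H, K = f H := fun K => by
    rw [exists_eq_list_prod_mul_iff (Finset.nodup_toList T)
      (by simpa only [Finset.mem_toList] using hT')]
    simp [Finset.subset_iff, bottom]
  rw [← tsum_mul_left, ← hf.tsum_eq]
  · refine tsum_congr fun H => ?_
    rw [if_pos ((hr _).2 ⟨H, rfl⟩), multWeight_mul, multWeight_list_prod, Finset.prod_map_toList]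
  · intro K hK
    by_contra h
    refine hK (if_neg fun h' => h ?_)
    obtain ⟨H, rfl⟩ := (hr K).1 h'
    exact ⟨H, rfl⟩

theorem tsum_multWeight_mul_sum_trivialHeaps [Finite L] [∀ i, Finite (X i)] (g : S.Piece → ℝ)
    (hg : Summable (multWeight g)) :
    (∑' H : S.Heap, multWeight g H) * ∑ T ∈ S.trivialHeaps, (-1 : ℝ) ^ T.card * ∏ π ∈ T, g π =
      1 := by
  classical
  have h1 : ∑' K : S.Heap, multWeight g K * (if K = 1 then 1 else 0) = 1 := by
    rw [tsum_eq_single 1 (by simp +contextual)]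
    simp
  refine Eq.trans ?_ h1
  simp_rw [← sum_trivialHeaps_subset_bottom, Finset.mul_sum]
  rw [Summable.tsum_finsetSum]
  · refine Finset.sum_congr rfl fun T hT => ?_
    rw [mul_left_comm, mul_comm (∑' H, _), ← tsum_subset_bottom g hT, ← tsum_mul_left]
    refine tsum_congr fun K => ?_
    split_ifs <;> ring
  · intro T _
    refine Summable.of_norm_bounded hg.norm fun K => ?_
    rw [norm_mul]
    refine mul_le_of_le_one_right (norm_nonneg _) ?_
    split_ifs <;> simp

end Heap

end ConstraintSystem

namespace ConstraintSystem

variable {ι L : Type*} {X : ι → Type*} {S : ConstraintSystem ι L X}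

/-! ### Extremal systems -/

/-- Every constraint only depends on the variables of its scope, and two distinct constraints that
are simultaneously violated have disjoint scopes. -/
structure IsExtremal (S : ConstraintSystem ι L X) : Prop where
  not_sat_congr : ∀ ⦃ℓ u u'⦄, (∀ i ∈ S.scope ℓ, u i = u' i) → ¬ S.Sat ℓ u → ¬ S.Sat ℓ u'
  eq_of_not_disjoint : ∀ ⦃u ℓ ℓ'⦄, ¬ S.Sat ℓ u → ¬ S.Sat ℓ' u →
    ¬ Disjoint (S.scope ℓ) (S.scope ℓ') → ℓ = ℓ'

/-- Each `prob i` is a probability on `X i`. -/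
structure IsProb [∀ i, Fintype (X i)] (S : ConstraintSystem ι L X) : Prop where
  nonneg : ∀ i x, 0 ≤ S.prob i x
  sum_eq_one : ∀ i, ∑ x, S.prob i x = 1

theorem bad_nonempty_iff [Fintype L] {u : ∀ i, X i} : (S.bad u).Nonempty ↔ ¬ S.Formula u := by
  simp [bad, Formula, Finset.filter_nonempty_iff]

theorem first_mem_bad [Fintype L] (σ : L → ℕ) {u : ∀ i, X i} (h : (S.bad u).Nonempty) :
    ¬ S.Sat (S.first σ u h) u := by
  simpa [bad, first] using ((S.bad u).exists_min_image σ h).choose_spec.1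

namespace Piece

/-- The assignment `u` takes the values of the piece `π` on its scope. -/
def Agrees (π : S.Piece) (u : ∀ i, X i) : Prop := ∀ i : S.scope π.index, u i = π.val i

theorem Agrees.not_sat (hS : S.IsExtremal) {π : S.Piece} {u : ∀ i, X i} (h : π.Agrees u) :
    ¬ S.Sat π.index u := by
  obtain ⟨⟨ℓ, v⟩, e, he, hv⟩ := π
  refine hS.not_sat_congr (fun i hi => ?_) he
  exact (congrFun hv ⟨i, hi⟩).trans (h ⟨i, hi⟩).symm

theorem Agrees.ext {π π' : S.Piece} {u : ∀ i, X i} (h : π.Agrees u) (h' : π'.Agrees u)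
    (hi : π.index = π'.index) : π = π' := by
  obtain ⟨⟨ℓ, v⟩, hv⟩ := π
  obtain ⟨⟨ℓ', v'⟩, hv'⟩ := π'
  obtain rfl : ℓ = ℓ' := hi
  obtain rfl : v = v' := funext fun i => (h i).symm.trans (h' i)
  rfl

open Classical in
/-- The assignment that coincides with `π` on the scope of `π` and with `u` elsewhere. -/
noncomputable def overwrite (π : S.Piece) (u : ∀ i, X i) : ∀ i, X i :=
  fun i => if h : i ∈ S.scope π.index then π.val ⟨i, h⟩ else u i

theorem overwrite_of_mem (π : S.Piece) (u : ∀ i, X i) (i : S.scope π.index) :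
    π.overwrite u i = π.val i := dif_pos i.2

theorem overwrite_of_notMem (π : S.Piece) (u : ∀ i, X i) {i : ι} (h : i ∉ S.scope π.index) :
    π.overwrite u i = u i := dif_neg h

theorem agrees_overwrite (π : S.Piece) (u : ∀ i, X i) : π.Agrees (π.overwrite u) :=
  π.overwrite_of_mem u

theorem overwrite_comm {π π' : S.Piece} (h : ¬ π.Concurrent π') (u : ∀ i, X i) :
    π.overwrite (π'.overwrite u) = π'.overwrite (π.overwrite u) := by
  funext i
  have hd : i ∈ S.scope π.index → i ∉ S.scope π'.index :=
    fun hi => Finset.disjoint_left.1 (not_not.1 h : Disjoint _ _) hi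
  unfold overwrite
  split_ifs <;> first | rfl | exact absurd ‹_› (hd ‹_›)

end Piece

theorem exists_piece_agrees {u : ∀ i, X i} {ℓ : L} (h : ¬ S.Sat ℓ u) :
    ∃ π : S.Piece, π.index = ℓ ∧ π.Agrees u :=
  ⟨⟨⟨ℓ, fun i => u i⟩, u, h, rfl⟩, rfl, fun _ => rfl⟩

theorem resampledPiece_agrees [Fintype L] (σ : L → ℕ) {u : ∀ i, X i} (h : (S.bad u).Nonempty) :
    (S.resampledPiece σ u h).Agrees u := fun _ => rfl

/-! ### The action of heaps on assignments -/

namespace Heap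

/-- The action of heaps on assignments: each piece overwrites the variables of its scope. -/
noncomputable def act : S.Heap →* Function.End (∀ i, X i) :=
  PresentedMonoid.lift (rels := S.HeapRel) (M := Function.End (∀ i, X i)) Piece.overwrite (by
    rintro a b ⟨π, π', h, rfl, rfl⟩
    rw [map_mul, map_mul]
    exact funext (Piece.overwrite_comm h))

theorem act_single (π : S.Piece) (u : ∀ i, X i) : act (single π) u = π.overwrite u := rfl

theorem act_one (u : ∀ i, X i) : act (1 : S.Heap) u = u := by rw [map_one]; rfl

theorem act_mul (H K : S.Heap) (u : ∀ i, X i) : act (H * K) u = act H (act K u) := by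
  rw [map_mul]; rfl

/-- A constraint violated by the assignment that `H` produces from a satisfying assignment is
attached to a piece at the bottom of `H`. -/
theorem exists_eq_single_mul_of_not_sat (hS : S.IsExtremal) {a : ∀ i, X i} (ha : S.Formula a)
    {ℓ : L} (H : S.Heap) (h : ¬ S.Sat ℓ (act H a)) :
    ∃ (π : S.Piece) (K : S.Heap), H = single π * K ∧ π.index = ℓ ∧ π.Agrees (act H a) := by
  induction H using cons_induction with
  | one => exact absurd (ha ℓ) (by rwa [act_one] at h)
  | mul π H ih =>
    rw [act_mul, act_single] at h ⊢
    have hπ := π.agrees_overwrite (act H a)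
    -- If `π` misses the scope of `ℓ`, the violation is already present in `act H a`, and the bottom
    -- piece found there slides past `π`. Otherwise extremality forces `ℓ` to be the constraint of
    -- `π`.
    by_cases hd : Disjoint (S.scope π.index) (S.scope ℓ)
    · have hsame : ∀ i ∈ S.scope ℓ, π.overwrite (act H a) i = act H a i := fun i hi =>
        π.overwrite_of_notMem _ (Finset.disjoint_right.1 hd hi)
      obtain ⟨ρ, K, rfl, rfl, hρ⟩ := ih (hS.not_sat_congr hsame h)
      refine ⟨ρ, single π * K, ?_, rfl, fun i => (hsame i i.2).trans (hρ i)⟩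
      rw [← mul_assoc, ← mul_assoc, single_mul_comm (not_not.2 hd)]
    · exact ⟨π, H, rfl, hS.eq_of_not_disjoint (hπ.not_sat hS) h hd, hπ⟩

instance [Finite L] [∀ i, Finite (X i)] : Countable S.Heap := by
  have : Countable (FreeMonoid S.Piece) := inferInstanceAs (Countable (List S.Piece))
  exact PresentedMonoid.surjective_mk.countable

end Heap

open Heap

/-! ### Inclusion-exclusion over trivial heaps -/

open Classical in
theorem Piece.weight_eq_prod [Fintype ι] (π : S.Piece) :
    π.weight = ∏ i, if h : i ∈ S.scope π.index then S.prob i (π.val ⟨i, h⟩) else 1 := by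
  rw [← Finset.prod_subset (Finset.subset_univ (S.scope π.index)) (fun i _ h => dif_neg h),
    ← Finset.prod_coe_sort]
  exact Finset.prod_congr rfl fun i _ => by rw [dif_pos i.2]

-- Since the scopes are disjoint, agreement with all the pieces of `T` is an intersection of
-- independent events.
open Classical in
theorem prod_weight_eq_sum [Fintype ι] [Finite L] [∀ i, Fintype (X i)] (hp : S.IsProb) {T : Finset S.Piece}
    (hT : T ∈ S.trivialHeaps) :
    ∏ π ∈ T, π.weight = ∑ u, if ∀ π ∈ T, π.Agrees u then S.prodProb u else 0 := by
  have hT' : ∀ π ∈ T, ∀ π' ∈ T, π ≠ π' → ¬ π.Concurrent π' := (Finset.mem_filter.1 hT).2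
  -- Agreement is split variable by variable, vacuously outside the scope, so that the sum over `u`
  -- becomes a product over `i`.
  let q (π : S.Piece) (i : ι) (x : X i) : Prop := ∀ h : i ∈ S.scope π.index, x = π.val ⟨i, h⟩
  let h (i : ι) (x : X i) : ℝ := S.prob i x * ∏ π ∈ T, if q π i x then 1 else 0
  have h1 : ∀ u, (if ∀ π ∈ T, π.Agrees u then S.prodProb u else 0) = ∏ i, h i (u i) := fun u => by
    simp only [h, Finset.prod_mul_distrib]
    rw [Finset.prod_comm]
    have h0 : (∏ π ∈ T, ∏ i, if q π i (u i) then (1 : ℝ) else 0) =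
        if ∀ π ∈ T, π.Agrees u then 1 else 0 := by
      split_ifs with hT
      · exact Finset.prod_eq_one fun π hπ => Finset.prod_eq_one fun i _ =>
          if_pos fun hi => hT π hπ ⟨i, hi⟩
      · simp only [Piece.Agrees, not_forall] at hT
        obtain ⟨π, hπ, i, hi⟩ := hT
        exact Finset.prod_eq_zero hπ
          (Finset.prod_eq_zero (Finset.mem_univ i.1) (if_neg fun hq => hi (hq i.2)))
    rw [h0, mul_ite, mul_one, mul_zero]
    rfl
  have h2 : ∀ i, ∑ x, h i x =
      ∏ π ∈ T, if h : i ∈ S.scope π.index then S.prob i (π.val ⟨i, h⟩) else 1 := fun i => by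
    by_cases hi : ∃ π ∈ T, i ∈ S.scope π.index
    · obtain ⟨π, hπ, hi⟩ := hi
      have hne : ∀ π' ∈ T, π' ≠ π → i ∉ S.scope π'.index := fun π' hπ' hne =>
        Finset.disjoint_left.1 (not_not.1 (hT' π hπ π' hπ' hne.symm) : Disjoint _ _) hi
      rw [Finset.prod_eq_single_of_mem π hπ fun π' hπ' hne' => dif_neg (hne π' hπ' hne'),
        dif_pos hi, Finset.sum_eq_single (π.val ⟨i, hi⟩)]
      · rw [show h i (π.val ⟨i, hi⟩) = _ * _ from rfl, Finset.prod_eq_one, mul_one]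
        intro π' hπ'
        refine if_pos fun hi' => ?_
        by_cases hππ : π' = π
        · subst hππ; rfl
        · exact absurd hi' (hne π' hπ' hππ)
      · intro x _ hx
        rw [show h i x = _ * _ from rfl, Finset.prod_eq_zero hπ, mul_zero]
        exact if_neg fun hq => hx (hq hi)
      · simp
    · push Not at hi
      rw [Finset.prod_eq_one fun π hπ => dif_neg (hi π hπ), ← hp.sum_eq_one i]
      refine Finset.sum_congr rfl fun x _ => ?_
      rw [show h i x = _ * _ from rfl, Finset.prod_eq_one, mul_one]
      exact fun π hπ => if_pos fun h => absurd h (hi π hπ)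
  simp_rw [h1]
  rw [← Fintype.piFinset_univ, ← Finset.prod_univ_sum]
  simp_rw [h2]
  rw [Finset.prod_comm]
  exact Finset.prod_congr rfl fun π _ => π.weight_eq_prod

-- By extremality the pieces that agree with `u` are pairwise non-concurrent, so the sum runs over
-- all subsets of this set, which is empty exactly when `u` satisfies `Φ`.
open Classical in
theorem sum_trivialHeaps_agrees [Finite L] [∀ i, Finite (X i)] (hS : S.IsExtremal)
    (u : ∀ i, X i) :
    (∑ T ∈ S.trivialHeaps, if ∀ π ∈ T, π.Agrees u then (-1 : ℝ) ^ T.card else 0) =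
      if S.Formula u then 1 else 0 := by
  let B : Finset S.Piece := Finset.univ.filter fun π => π.Agrees u
  rw [← Finset.sum_filter]
  have : S.trivialHeaps.filter (fun T => ∀ π ∈ T, π.Agrees u) = B.powerset := by
    ext T
    simp only [Finset.mem_filter, Finset.mem_powerset, trivialHeaps, Finset.mem_univ, true_and, B,
      Finset.subset_iff, and_iff_right_iff_imp]
    intro hT π hπ π' hπ' hne hc
    exact hne ((hT π hπ).ext (hT π' hπ')
      (hS.eq_of_not_disjoint ((hT π hπ).not_sat hS) ((hT π' hπ').not_sat hS) hc))
  have hB : B = ∅ ↔ S.Formula u := by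
    simp only [B, Finset.filter_eq_empty_iff, Finset.mem_univ, true_implies]
    constructor
    · intro h ℓ
      by_contra hℓ
      obtain ⟨π, -, hπ⟩ := exists_piece_agrees hℓ
      exact h hπ
    · exact fun h π hπ => hπ.not_sat hS (h _)
  have h := congrArg (Int.cast (R := ℝ)) (Finset.sum_powerset_neg_one_pow_card (x := B))
  push_cast at h
  rw [this, h]
  simp only [hB]

open Classical in
theorem sum_trivialHeaps_weight [Fintype ι] [Finite L] [∀ i, Fintype (X i)] (hS : S.IsExtremal)
    (hp : S.IsProb) :
    ∑ T ∈ S.trivialHeaps, (-1 : ℝ) ^ T.card * ∏ π ∈ T, π.weight =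
      ∑ u, if S.Formula u then S.prodProb u else 0 := by
  calc _ = ∑ T ∈ S.trivialHeaps, ∑ u,
        S.prodProb u * if ∀ π ∈ T, π.Agrees u then (-1 : ℝ) ^ T.card else 0 := by
        refine Finset.sum_congr rfl fun T hT => ?_
        rw [prod_weight_eq_sum hp hT, Finset.mul_sum]
        refine Finset.sum_congr rfl fun u _ => ?_
        split_ifs <;> ring
    _ = _ := by
        rw [Finset.sum_comm]
        refine Finset.sum_congr rfl fun u _ => ?_
        rw [← Finset.mul_sum, sum_trivialHeaps_agrees hS]
        split_ifs <;> simp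

/-! ### Runs -/

section Runs

variable [Fintype L] {σ : L → ℕ}

theorem resampledHeap_of_not_formula {u : ∀ i, X i} (h : ¬ S.Formula u) :
    S.resampledHeap σ u = single (S.resampledPiece σ u (bad_nonempty_iff.2 h)) :=
  dif_pos _

theorem resampledHeap_of_formula {u : ∀ i, X i} (h : S.Formula u) : S.resampledHeap σ u = 1 :=
  dif_neg fun h' => bad_nonempty_iff.1 h' h

/-- Putting the resampled values back undoes the step; this is what makes the chain readable
backwards. -/
theorem act_resampledHeap_of_transition_ne_zero {u u' : ∀ i, X i}
    (h : S.transition σ u u' ≠ 0) : act (S.resampledHeap σ u) u' = u := by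
  by_cases hu : S.Formula u
  · rw [resampledHeap_of_formula hu, act_one]
    rw [transition, dif_neg fun h' => bad_nonempty_iff.1 h' hu] at h
    by_contra hne
    exact h (if_neg hne)
  · have hb : (S.bad u).Nonempty := bad_nonempty_iff.2 hu
    rw [transition, dif_pos hb] at h
    have h' : ∀ i, i ∉ S.scope (S.first σ u hb) → u' i = u i := by
      by_contra hne
      exact h (if_neg hne)
    rw [resampledHeap_of_not_formula hu, act_single]
    funext i
    by_cases hi : i ∈ S.scope (S.first σ u hb)
    · exact Piece.overwrite_of_mem _ _ ⟨i, hi⟩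
    · exact (Piece.overwrite_of_notMem _ _ hi).trans (h' i hi)

/-- At a resampling, both sides multiply the old values in the scope, the new values in the scope
and the common values outside it. -/
theorem prodProb_mul_transition [Fintype ι] {u u' : ∀ i, X i}
    (h : act (S.resampledHeap σ u) u' = u) :
    S.prodProb u * S.transition σ u u' = (S.resampledHeap σ u).weight * S.prodProb u' := by
  classical
  by_cases hu : S.Formula u
  · rw [resampledHeap_of_formula hu, act_one] at h
    rw [resampledHeap_of_formula hu, transition, dif_neg fun h' => bad_nonempty_iff.1 h' hu,
      if_pos h, h]
    simp [Heap.weight]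
  · have hb : (S.bad u).Nonempty := bad_nonempty_iff.2 hu
    rw [resampledHeap_of_not_formula hu, act_single] at h
    have h' : ∀ i, i ∉ S.scope (S.first σ u hb) → u' i = u i := fun i hi => by
      rw [← Piece.overwrite_of_notMem (S.resampledPiece σ u hb) u' hi, h]
    rw [resampledHeap_of_not_formula hu, transition, dif_pos hb, if_pos h']
    have hw : (single (S.resampledPiece σ u hb)).weight =
        ∏ i ∈ S.scope (S.first σ u hb), S.prob i (u i) := by
      rw [← Finset.prod_coe_sort]
      exact multWeight_single Piece.weight _
    rw [hw, prodProb, prodProb, ← Finset.prod_mul_prod_compl (S.scope (S.first σ u hb)),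
      ← Finset.prod_mul_prod_compl (S.scope (S.first σ u hb)) fun i => S.prob i (u' i),
      Finset.prod_congr (rfl : (S.scope (S.first σ u hb))ᶜ = _) fun i hi =>
        congrArg (S.prob i) (h' i (Finset.mem_compl.1 hi))]
    ring

variable (S σ) in
/-- The heap of the pieces resampled during the first `n` steps of `e`. -/
noncomputable def runHeap (e : ℕ → ∀ i, X i) (n : ℕ) : S.Heap :=
  ((List.range n).map fun j => S.resampledHeap σ (e j)).prod

@[simp] theorem runHeap_zero (e : ℕ → ∀ i, X i) : S.runHeap σ e 0 = 1 := rfl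

theorem runHeap_succ (e : ℕ → ∀ i, X i) (n : ℕ) :
    S.runHeap σ e (n + 1) = S.runHeap σ e n * S.resampledHeap σ (e n) := by
  simp [runHeap, List.range_succ]

theorem runHeap_succ' (e : ℕ → ∀ i, X i) (n : ℕ) :
    S.runHeap σ e (n + 1) = S.resampledHeap σ (e 0) * S.runHeap σ (fun j => e (j + 1)) n := by
  simp [runHeap, List.range_succ_eq_map, Function.comp_def]

theorem runHeap_congr {e e' : ℕ → ∀ i, X i} {n : ℕ} (h : ∀ j < n, e j = e' j) :
    S.runHeap σ e n = S.runHeap σ e' n := by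
  unfold runHeap
  congr 1
  exact List.map_congr_left fun j hj => by rw [h j (List.mem_range.1 hj)]

variable (S σ) in
/-- During its first `n` steps, `e` violates some constraint and only changes the variables
that are resampled. -/
structure IsRun (e : ℕ → ∀ i, X i) (n : ℕ) : Prop where
  not_formula : ∀ j < n, ¬ S.Formula (e j)
  act_eq : ∀ j < n, act (S.resampledHeap σ (e j)) (e (j + 1)) = e j

namespace IsRun

variable {e e' : ℕ → ∀ i, X i} {n : ℕ}

theorem tail (h : S.IsRun σ e (n + 1)) : S.IsRun σ (fun j => e (j + 1)) n :=
  ⟨fun j hj => h.1 (j + 1) (by omega), fun j hj => h.2 (j + 1) (by omega)⟩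

theorem card_pieces (h : S.IsRun σ e n) : (S.runHeap σ e n).pieces.card = n := by
  induction n with
  | zero => simp
  | succ n ih =>
    rw [runHeap_succ, resampledHeap_of_not_formula (h.1 n (by omega)), pieces_mul,
      Multiset.card_add, ih ⟨fun j hj => h.1 j (by omega), fun j hj => h.2 j (by omega)⟩]
    rfl

theorem act_runHeap (h : S.IsRun σ e n) : act (S.runHeap σ e n) (e n) = e 0 := by
  induction n generalizing e with
  | zero => rw [runHeap_zero, act_one]
  | succ n ih => rw [runHeap_succ', act_mul, ih h.tail, h.2 0 (by omega)]

/-- The heap acting on the final state recovers the initial state, hence the first piece; cancel it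
and repeat. -/
theorem unique (h : S.IsRun σ e n) (h' : S.IsRun σ e' n)
    (hH : S.runHeap σ e n = S.runHeap σ e' n) (hn : e n = e' n) : ∀ j ≤ n, e j = e' j := by
  induction n generalizing e e' with
  | zero => simpa using hn
  | succ n ih =>
    have h0 : e 0 = e' 0 := by rw [← h.act_runHeap, ← h'.act_runHeap, hH, hn]
    rw [runHeap_succ', runHeap_succ', ← h0,
      resampledHeap_of_not_formula (h.1 0 (by omega))] at hH
    rintro (_ | j) hj
    · exact h0
    · exact ih h.tail h'.tail (single_mul_left_cancel hH) hn j (by omega)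

theorem prodProb_mul_prod_transition [Fintype ι] (h : S.IsRun σ e n) :
    S.prodProb (e 0) * ∏ j ∈ Finset.range n, S.transition σ (e j) (e (j + 1)) =
      (S.runHeap σ e n).weight * S.prodProb (e n) := by
  induction n with
  | zero => simp [Heap.weight]
  | succ n ih =>
    rw [Finset.prod_range_succ, ← mul_assoc,
      ih ⟨fun j hj => h.1 j (by omega), fun j hj => h.2 j (by omega)⟩, mul_assoc,
      prodProb_mul_transition (h.2 n (by omega)), ← mul_assoc, runHeap_succ]
    congr 1
    exact (multWeight_mul Piece.weight _ _).symm

theorem stopTime_eq (h : S.IsRun σ e n) (hn : S.Formula (e n)) : S.stopTime e = n := by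
  refine le_antisymm (Nat.sInf_le hn) ?_
  by_contra! hlt
  exact h.1 _ hlt (Nat.sInf_mem (s := {k | S.Formula (e k)}) ⟨n, hn⟩)

theorem split_eq (h : S.IsRun σ e n) (hn : S.Formula (e n)) :
    S.split σ e = (S.runHeap σ e n, e n) := by
  rw [split, h.stopTime_eq hn]
  rfl

theorem of_split (hE : ∀ j, act (S.resampledHeap σ (e j)) (e (j + 1)) = e j) :
    S.IsRun σ e (S.stopTime e) :=
  -- A path that never satisfies `Φ` has `stopTime` 0, and the claim is then vacuous.
  ⟨fun _ hj => Nat.notMem_of_lt_sInf hj, fun j _ => hE j⟩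

end IsRun

/-- Start from `act H a`: the piece of its first violated constraint is at the bottom of `H`. Remove
it and continue with the rest, whatever the order `σ`. -/
theorem exists_isRun (hS : S.IsExtremal) (σ : L → ℕ) {a : ∀ i, X i} (ha : S.Formula a) (n : ℕ)
    (H : S.Heap) (hn : H.pieces.card = n) :
    ∃ e, S.IsRun σ e n ∧ S.runHeap σ e n = H ∧ e n = a ∧ e 0 = act H a := by
  induction n generalizing H with
  | zero =>
    refine ⟨fun _ => a, ⟨by simp, by simp⟩, ?_, rfl, ?_⟩ <;> rw [eq_one_of_card_pieces hn]
    · rfl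
    · rw [act_one]
  | succ n ih =>
    have hu : ¬ S.Formula (act H a) := by
      obtain ⟨π, K, rfl⟩ := exists_of_ne_one (H := H) (by rintro rfl; simp at hn)
      rw [act_mul, act_single]
      exact fun h => (π.agrees_overwrite (act K a)).not_sat hS (h _)
    have hb := bad_nonempty_iff.2 hu
    obtain ⟨π, K, hK, hi, hπ⟩ := exists_eq_single_mul_of_not_sat hS ha H (first_mem_bad σ hb)
    obtain rfl : π = S.resampledPiece σ _ hb := hπ.ext (resampledPiece_agrees σ hb) hi
    obtain ⟨e, he, heK, hea, he0⟩ := ih K (by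
      have := congrArg (fun H => H.pieces.card) hK
      simp only [hn, pieces_mul, pieces_single, Multiset.card_add, Multiset.card_singleton] at this
      omega)
    have hH : H = S.resampledHeap σ (act H a) * K := by
      rw [resampledHeap_of_not_formula hu]; exact hK
    refine ⟨fun j => Nat.casesOn j (act H a) e, ⟨?_, ?_⟩, ?_, hea, rfl⟩
    · rintro (_ | j) hj
      · exact hu
      · exact he.1 j (by omega)
    · rintro (_ | j) hj
      · change act (S.resampledHeap σ (act H a)) (e 0) = act H a
        rw [he0, ← act_mul, ← hH]
      · exact he.2 j (by omega)
    · rw [runHeap_succ']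
      change S.resampledHeap σ (act H a) * S.runHeap σ e n = H
      rw [heK, ← hH]

end Runs

end ConstraintSystem

namespace ConstraintSystem

variable {ι L : Type*} {X : ι → Type*} {S : ConstraintSystem ι L X}

open Heap

/-! ### The law of the heap and of the output -/

theorem Heap.weight_nonneg [∀ i, Fintype (X i)] (hp : S.IsProb) (H : S.Heap) : 0 ≤ H.weight := by
  refine Multiset.prod_nonneg fun x hx => ?_
  obtain ⟨π, -, rfl⟩ := Multiset.mem_map.1 hx
  exact Finset.prod_nonneg fun i _ => hp.nonneg _ _

theorem IsPRSChain.measurableSet_path [Fintype ι] [Fintype L] {σ : L → ℕ} {Ω : Type*}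
    [MeasurableSpace Ω] {P : Measure Ω} {E : ℕ → Ω → ∀ i, X i} (hE : S.IsPRSChain σ P E) (n : ℕ) (e : ℕ → ∀ i, X i) :
    MeasurableSet {ω | ∀ j ≤ n, E j ω = e j} := by
  simp only [Set.ofPred_forall]
  exact MeasurableSet.iInter fun j => MeasurableSet.iInter fun _ => hE.measurableSet_eq j _

variable [Fintype ι] [Fintype L] [∀ i, Fintype (X i)] {σ : L → ℕ}
  {Ω : Type*} [MeasurableSpace Ω] {P : Measure Ω} [IsProbabilityMeasure P]
  {E : ℕ → Ω → ∀ i, X i}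

namespace IsPRSChain

theorem ae_transition_ne_zero (hE : S.IsPRSChain σ P E) :
    ∀ᵐ ω ∂P, ∀ k, S.transition σ (E k ω) (E (k + 1) ω) ≠ 0 := by
  rw [ae_all_iff]
  intro k
  -- `path_law` expects an infinite sequence; only its indices up to `k + 1` matter, so any
  -- extension of the tuple will do.
  let ext (p : Fin (k + 2) → ∀ i, X i) (j : ℕ) : ∀ i, X i := p (Fin.ofNat (k + 2) j)
  have hnull : P (⋃ p : {p : Fin (k + 2) → ∀ i, X i //
      S.transition σ (ext p k) (ext p (k + 1)) = 0}, {ω | ∀ j ≤ k + 1, E j ω = ext p j}) = 0 := by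
    classical
    refine measure_iUnion_null fun p => ?_
    refine (measureReal_eq_zero_iff).1 ?_
    rw [hE.path_law, Finset.prod_eq_zero (i := k) (by simp) p.2, mul_zero]
  rw [ae_iff]
  refine measure_mono_null (fun ω hω => ?_) hnull
  have hext : ∀ j ≤ k + 1, E j ω = ext (fun i => E i ω) j := fun j hj => by
    simp only [ext, Fin.val_ofNat]
    rw [Nat.mod_eq_of_lt (by omega)]
  refine Set.mem_iUnion.2 ⟨⟨fun i => E i ω, ?_⟩, hext⟩
  rw [← hext k (by omega), ← hext (k + 1) le_rfl]
  simpa using hω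

/-- `A` is the cylinder of the unique run with heap `H` and output `a`. It agrees with the event on
`split` only almost surely, since paths with forbidden transitions must be discarded. -/
theorem exists_event (hS : S.IsExtremal) (hE : S.IsPRSChain σ P E) (H : S.Heap) {a : ∀ i, X i}
    (ha : S.Formula a) :
    ∃ A, MeasurableSet A ∧ (∀ ω ∈ A, S.split σ (fun k => E k ω) = (H, a)) ∧
      (∀ ω ∈ A, ∃ k, S.Formula (E k ω)) ∧
      {ω | S.split σ (fun k => E k ω) = (H, a)} =ᵐ[P] A ∧
      P.real A = H.weight * S.prodProb a := by
  obtain ⟨e, he, heH, hea, -⟩ := exists_isRun hS σ ha _ H rfl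
  have hsub : ∀ ω, (∀ j ≤ H.pieces.card, E j ω = e j) → S.IsRun σ (fun k => E k ω) H.pieces.card ∧
      S.runHeap σ (fun k => E k ω) H.pieces.card = H := fun ω hω => by
    refine ⟨⟨fun j hj => ?_, fun j hj => ?_⟩, ?_⟩
    · rw [hω j hj.le]; exact he.1 j hj
    · rw [hω j hj.le, hω (j + 1) hj]; exact he.2 j hj
    · exact (runHeap_congr fun j hj => hω j hj.le).trans heH
  have hend : ∀ ω, (∀ j ≤ H.pieces.card, E j ω = e j) → E H.pieces.card ω = a :=
    fun ω hω => (hω _ le_rfl).trans hea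
  have hsplit : ∀ ω, (∀ j ≤ H.pieces.card, E j ω = e j) →
      S.split σ (fun k => E k ω) = (H, a) := fun ω hω => by
    rw [(hsub ω hω).1.split_eq (by rw [hend ω hω]; exact ha), (hsub ω hω).2, hend ω hω]
  refine ⟨_, hE.measurableSet_path H.pieces.card e, hsplit,
    fun ω hω => ⟨_, by rw [hend ω hω]; exact ha⟩, ?_, ?_⟩
  · filter_upwards [hE.ae_transition_ne_zero] with ω hω
    refine propext ⟨fun h => ?_, hsplit ω⟩
    have hrun := IsRun.of_split fun j => act_resampledHeap_of_transition_ne_zero (hω j)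
    have h1 : S.runHeap σ (fun k => E k ω) (S.stopTime fun k => E k ω) = H :=
      congrArg Prod.fst h
    have h2 : E (S.stopTime fun k => E k ω) ω = a := congrArg Prod.snd h
    have hn : (S.stopTime fun k => E k ω) = H.pieces.card := by
      rw [← hrun.card_pieces, h1]
    rw [hn] at hrun h1 h2
    exact hrun.unique he (h1.trans heH.symm) (h2.trans hea.symm)
  · rw [hE.path_law, he.prodProb_mul_prod_transition, heH, hea]

/-- Partial rejection sampling of an extremal system terminates almost surely, its heap and its
output are independent, and the generating function of the heap is a ratio of alternating sums
over trivial heaps. -/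
theorem law (hS : S.IsExtremal) (hp : S.IsProb) (hpos : ∃ a, S.Formula a ∧ 0 < S.prodProb a)
    (hE : S.IsPRSChain σ P E) (t : L → ℝ) (ht : ∀ ℓ, 0 < t ℓ ∧ t ℓ < 1) :
    (∀ᵐ ω ∂P, ∃ k, S.Formula (E k ω)) ∧
    (∀ (H : S.Heap) (a : ∀ i, X i), S.Formula a →
      P.real {ω | S.split σ (fun k => E k ω) = (H, a)} = H.weight * S.prodProb a) ∧
    Integrable (fun ω => ∏ ℓ, t ℓ ^ (S.split σ (fun k => E k ω)).1.count ℓ) P ∧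
    0 < ∑ T ∈ S.trivialHeaps, (-1 : ℝ) ^ T.card * (∏ π ∈ T, π.weight) * ∏ π ∈ T, t π.index ∧
    ∫ ω, ∏ ℓ, t ℓ ^ (S.split σ (fun k => E k ω)).1.count ℓ ∂P =
      (∑ T ∈ S.trivialHeaps, (-1 : ℝ) ^ T.card * ∏ π ∈ T, π.weight) /
        ∑ T ∈ S.trivialHeaps,
          (-1 : ℝ) ^ T.card * (∏ π ∈ T, π.weight) * ∏ π ∈ T, t π.index := by
  classical
  obtain ⟨a₀, ha₀, ha₀pos⟩ := hpos
  have hprob : ∀ a, 0 ≤ S.prodProb a := fun a => Finset.prod_nonneg fun i _ => hp.nonneg _ _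
  -- the total mass of the satisfying assignments
  set Z := ∑ T ∈ S.trivialHeaps, (-1 : ℝ) ^ T.card * ∏ π ∈ T, π.weight with hZ
  have hZsum : ∑ a : {a // S.Formula a}, S.prodProb a.1 = Z := by
    rw [hZ, sum_trivialHeaps_weight hS hp, ← Finset.sum_filter]
    exact (Finset.sum_subtype _ (by simp) S.prodProb).symm
  have hZpos : 0 < Z := by
    rw [← hZsum]
    exact Finset.sum_pos' (fun a _ => hprob _) ⟨⟨a₀, ha₀⟩, Finset.mem_univ _, ha₀pos⟩
  have hevent : ∀ p : S.Heap × {a // S.Formula a}, _ := fun p => exists_event hS hE p.1 p.2.2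
  choose A hAmeas hAsplit hAstop hAae hAprob using hevent
  have hAdisj : Pairwise (Function.onFun Disjoint A) := fun p q hpq => by
    refine Set.disjoint_left.2 fun ω h h' => hpq ?_
    have := (hAsplit p ω h).symm.trans (hAsplit q ω h')
    exact Prod.ext (Prod.mk.inj this).1 (Subtype.ext (Prod.mk.inj this).2)
  -- the weights of the heaps are summable
  have hAsum : HasSum (fun p => P.real (A p)) (P.real (⋃ p, A p)) := by
    have := hasSum_integral_iUnion hAmeas hAdisj (f := fun _ => (1 : ℝ)) (μ := P)
      (integrable_const _).integrableOn
    simpa using this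
  -- Keep only the events with output `a₀` and divide by its positive probability.
  have hwsum : Summable (multWeight (S := S) Piece.weight) := by
    have h := hAsum.summable.comp_injective (i := fun H : S.Heap => (H, ⟨a₀, ha₀⟩))
      fun H K h => congrArg Prod.fst h
    refine (summable_mul_right_iff ha₀pos.ne').1 (h.congr fun H => ?_)
    simp only [Function.comp, hAprob]
    rfl
  have hprod : ∀ g : S.Heap → ℝ, Summable g →
      HasSum (fun p : S.Heap × {a // S.Formula a} => g p.1 * S.prodProb p.2.1)
        ((∑' H, g H) * Z) := fun g hg => by
    rw [← hZsum]
    exact hg.hasSum.mul (hasSum_fintype _)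
      (hg.norm.mul_norm (Summable.of_finite (f := fun a : {a // S.Formula a} => ‖S.prodProb a.1‖))).of_norm
  -- The total mass is the sum of the heap weights times `Z`, which the inversion formula makes
  -- equal to 1. Almost sure termination follows.
  have hfull : P (⋃ p, A p)ᶜ = 0 := by
    have h1 : P.real (⋃ p, A p) = 1 := by
      rw [← tsum_multWeight_mul_sum_trivialHeaps Piece.weight hwsum]
      refine hAsum.unique ?_
      simp_rw [hAprob]
      exact hprod _ hwsum
    rw [prob_compl_eq_zero_iff (MeasurableSet.iUnion hAmeas)]
    rwa [measureReal_def, ENNReal.toReal_eq_one_iff] at h1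
  have hrestrict : P.restrict (⋃ p, A p) = P :=
    Measure.restrict_eq_self_of_ae_mem (by rw [ae_iff]; exact hfull)
  -- the generating function
  let f : S.Heap → ℝ := fun H => ∏ ℓ, t ℓ ^ H.count ℓ
  have hf : ∀ H, f H = multWeight (fun π => t π.index) H := fun H => by
    simp only [f, multWeight, Heap.count]
    rw [← Function.comp_def t, ← Multiset.map_map, Finset.prod_multiset_map_count]
    refine (Finset.prod_subset (Finset.subset_univ _) fun ℓ _ h => ?_).symm
    rw [Multiset.mem_toFinset] at h
    rw [Multiset.count_eq_zero_of_notMem h, pow_zero]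
  have hf0 : ∀ H, 0 ≤ f H := fun H => Finset.prod_nonneg fun ℓ _ => pow_nonneg (ht ℓ).1.le _
  have hf1 : ∀ H, f H ≤ 1 := fun H => Finset.prod_le_one
    (fun ℓ _ => pow_nonneg (ht ℓ).1.le _) fun ℓ _ => pow_le_one₀ (ht ℓ).1.le (ht ℓ).2.le
  let g : S.Piece → ℝ := fun π => π.weight * t π.index
  have hg : ∀ H, multWeight g H = H.weight * f H := fun H => by
    rw [hf]
    exact Multiset.prod_map_mul
  have hgsum : Summable (multWeight g) := by
    refine Summable.of_nonneg_of_le (fun H => ?_) (fun H => ?_) hwsum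
    · rw [hg]; exact mul_nonneg (Heap.weight_nonneg hp H) (hf0 H)
    · rw [hg]; exact mul_le_of_le_one_right (Heap.weight_nonneg hp H) (hf1 H)
  have hinv := tsum_multWeight_mul_sum_trivialHeaps g hgsum
  simp only [g, Finset.prod_mul_distrib, ← mul_assoc] at hinv
  set D := ∑ T ∈ S.trivialHeaps, (-1 : ℝ) ^ T.card * (∏ π ∈ T, π.weight) * ∏ π ∈ T, t π.index
  -- The empty heap contributes 1; as the product of this sum with `D` is 1, `D` is positive too.
  have hWpos : 0 < ∑' H : S.Heap, multWeight g H := by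
    refine hgsum.tsum_pos (fun H => ?_) 1 (by simp)
    rw [hg]; exact mul_nonneg (Heap.weight_nonneg hp H) (hf0 H)
  have hDpos : 0 < D := pos_of_mul_pos_right (hinv ▸ one_pos) hWpos.le
  have hconst : ∀ p, ∀ ω ∈ A p, f (S.split σ (fun k => E k ω)).1 = f p.1 := fun p ω hω => by
    rw [hAsplit p ω hω]
  have hint : Integrable (fun ω => f (S.split σ (fun k => E k ω)).1) P := by
    refine Integrable.of_bound (C := 1) ?_ (Filter.Eventually.of_forall fun ω => ?_)
    · rw [← hrestrict, aestronglyMeasurable_iUnion_iff]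
      exact fun p => (aestronglyMeasurable_const (b := f p.1)).congr
        ((ae_restrict_mem (hAmeas p)).mono fun ω hω => (hconst p ω hω).symm)
    · rw [Real.norm_of_nonneg (hf0 _)]
      exact hf1 _
  refine ⟨?_, fun H a ha => ?_, hint, hDpos, ?_⟩
  · rw [ae_iff]
    refine measure_mono_null (fun ω hω => Set.mem_compl fun h => ?_) hfull
    obtain ⟨p, hωp⟩ := Set.mem_iUnion.1 h
    exact Set.mem_ofPred.1 hω (hAstop p ω hωp)
  · rw [← hAprob (H, ⟨a, ha⟩), measureReal_congr (hAae (H, ⟨a, ha⟩))]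
  · rw [eq_div_iff hDpos.ne']
    have h1 := hasSum_integral_iUnion hAmeas hAdisj hint.integrableOn
    rw [hrestrict] at h1
    have h2 : ∀ p, ∫ ω in A p, f (S.split σ (fun k => E k ω)).1 ∂P =
        multWeight g p.1 * S.prodProb p.2.1 := fun p => by
      rw [setIntegral_congr_fun (hAmeas p) (hconst p), setIntegral_const, hAprob, hg, smul_eq_mul]
      ring
    simp_rw [h2] at h1
    have h3 := h1.unique (hprod _ hgsum)
    change (∫ ω, f (S.split σ (fun k => E k ω)).1 ∂P) * D = Z
    rw [h3, mul_right_comm, hinv, one_mul]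

end IsPRSChain

end ConstraintSystem

/-! ### Cycles of a functional graph -/

theorem List.isChain_cons_append_singleton_imp {V : Type*} {r r' : V → V → Prop} {x z : V}
    {l : List V} (h : List.IsChain r (x :: (l ++ [z])))
    (hr : ∀ a ∈ x :: l, ∀ b, r a b → r' a b) : List.IsChain r' (x :: (l ++ [z])) := by
  induction l generalizing x with
  | nil => simpa using hr x (by simp) z (by simpa using h)
  | cons y l ih =>
    obtain ⟨h1, h2⟩ := List.isChain_cons_cons.1 h
    exact List.isChain_cons_cons.2 ⟨hr x (by simp) y h1,
      ih h2 fun a ha => hr a (List.mem_cons_of_mem _ ha)⟩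

namespace Cycle

variable {V : Type*}

theorem exists_eq_cons_of_mem {c : Cycle V} {x : V} (h : x ∈ c) :
    ∃ l : List V, c = ((x :: l : List V) : Cycle V) := by
  induction c using Quotient.inductionOn' with
  | h l =>
    obtain ⟨s, t, rfl⟩ := List.append_of_mem (Cycle.mem_coe_iff.1 h)
    refine ⟨t ++ s, Cycle.coe_eq_coe.2 ?_⟩
    simpa using List.isRotated_append (l := s) (l' := x :: t)

theorem Chain.exists_rel {r : V → V → Prop} {c : Cycle V} (h : c.Chain r) {x : V} (hx : x ∈ c) :
    ∃ y ∈ c, r x y := by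
  obtain ⟨l, rfl⟩ := exists_eq_cons_of_mem hx
  rw [Cycle.chain_coe_cons] at h
  rcases l with _ | ⟨y, l⟩
  · exact ⟨x, by simp, by simpa using h⟩
  · exact ⟨y, by simp, (List.isChain_cons_cons.1 h).1⟩

theorem Chain.rel_apply {r : V → V → Prop} {f : V → V} {c : Cycle V} (h : c.Chain r)
    (hf : c.Chain fun x y => f x = y) {x : V} (hx : x ∈ c) : r x (f x) := by
  obtain ⟨l, rfl⟩ := exists_eq_cons_of_mem hx
  rw [Cycle.chain_coe_cons] at h hf
  rcases l with _ | ⟨y, l⟩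
  · rw [show f x = x by simpa using hf]
    simpa using h
  · rw [(List.isChain_cons_cons.1 hf).1]
    exact (List.isChain_cons_cons.1 h).1

theorem Chain.imp_of_mem {r r' : V → V → Prop} {c : Cycle V} (h : c.Chain r)
    (hr : ∀ x ∈ c, ∀ y, r x y → r' x y) : c.Chain r' := by
  induction c using Quotient.inductionOn' with
  | h l =>
    rcases l with _ | ⟨x, l⟩
    · trivial
    · change Cycle.Chain r ((x :: l : List V) : Cycle V) at h
      change Cycle.Chain r' ((x :: l : List V) : Cycle V)
      change ∀ z ∈ ((x :: l : List V) : Cycle V), _ at hr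
      simp only [Cycle.mem_coe_iff] at hr
      rw [Cycle.chain_coe_cons] at h ⊢
      exact List.isChain_cons_append_singleton_imp h hr

/-- Both lists consist of the iterates of `f` from `x`, up to the first visit to `z`. -/
theorem _root_.List.eq_of_isChain_apply {f : V → V} {z : V} {l l' : List V} (x : V)
    (h : List.IsChain (fun a b => f a = b) (x :: (l ++ [z])))
    (h' : List.IsChain (fun a b => f a = b) (x :: (l' ++ [z]))) (hz : z ∉ l) (hz' : z ∉ l') :
    l = l' := by
  induction l generalizing x l' with
  | nil =>
    rcases l' with _ | ⟨y, l'⟩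
    · rfl
    · have h1 : f x = z := by simpa using h
      have h2 : f x = y := (List.isChain_cons_cons.1 h').1
      simp [← h1, ← h2] at hz'
  | cons y l ih =>
    rcases l' with _ | ⟨y', l'⟩
    · have h1 : f x = z := by simpa using h'
      have h2 : f x = y := (List.isChain_cons_cons.1 h).1
      simp [← h1, ← h2] at hz
    · obtain ⟨h1, h2⟩ := List.isChain_cons_cons.1 h
      obtain ⟨h1', h2'⟩ := List.isChain_cons_cons.1 h'
      obtain rfl : y = y' := h1.symm.trans h1'
      rw [ih y h2 h2' (fun hm => hz (by simp [hm])) (fun hm => hz' (by simp [hm]))]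

/-- Two cycles without repetition of the functional graph of `f` that share a node are equal. -/
theorem eq_of_chain_apply {f : V → V} {c c' : Cycle V} (hc : c.Nodup) (hc' : c'.Nodup)
    (h : c.Chain fun x y => f x = y) (h' : c'.Chain fun x y => f x = y) {x : V} (hx : x ∈ c)
    (hx' : x ∈ c') : c = c' := by
  obtain ⟨l, rfl⟩ := exists_eq_cons_of_mem hx
  obtain ⟨l', rfl⟩ := exists_eq_cons_of_mem hx'
  rw [Cycle.nodup_coe_iff, List.nodup_cons] at hc hc'
  rw [Cycle.chain_coe_cons] at h h'
  rw [List.eq_of_isChain_apply x h h' hc.1 hc'.1]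

theorem _root_.List.exists_isChain_apply (z x : V) (l : List V) (h : (x :: l).Nodup) :
    ∃ f : V → V, List.IsChain (fun a b => f a = b) (x :: (l ++ [z])) := by
  classical
  induction l generalizing x with
  | nil => exact ⟨fun _ => z, by simp⟩
  | cons y l ih =>
    obtain ⟨hx, hl⟩ := List.nodup_cons.1 h
    obtain ⟨f, hf⟩ := ih y hl
    -- Without repetition, `x` is not a source of any later step, so redefining `f` there is
    -- harmless.
    refine ⟨Function.update f x y, List.isChain_cons_cons.2 ⟨by simp, ?_⟩⟩
    refine List.isChain_cons_append_singleton_imp hf fun a ha b hab => ?_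
    rwa [Function.update_of_ne (by rintro rfl; exact hx ha)]

/-- A cycle without repetition is a cycle of some functional graph. -/
theorem Nodup.exists_chain_apply [Nonempty V] {c : Cycle V} (hc : c.Nodup) :
    ∃ f : V → V, c.Chain fun x y => f x = y := by
  induction c using Quotient.inductionOn' with
  | h l =>
    rcases l with _ | ⟨x, l⟩
    · exact ⟨fun x => x, trivial⟩
    · exact List.exists_isChain_apply x x l (Cycle.nodup_coe_iff.1 hc)

end Cycle

/-! ### The system of cycle popping -/

namespace CyclePopping

variable {V : Type u} {G : SimpleGraph V}

theorem Contains.congr {a a' : ∀ i, Val G i} {c : OrientedCycle G}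
    (h : ∀ x ∈ c.1, succ a x = succ a' x) (hc : Contains a c) : Contains a' c :=
  hc.imp_of_mem fun x hx _ hxy => (h x hx).symm.trans hxy

theorem Contains.eq_of_mem {a : ∀ i, Val G i} {c d : OrientedCycle G} (hc : Contains a c)
    (hd : Contains a d) {x : V} (hxc : x ∈ c.1) (hxd : x ∈ d.1) : c = d :=
  Subtype.ext (Cycle.eq_of_chain_apply c.2.1.1 d.2.1.1 hc hd hxc hxd)

variable [Fintype V]

@[simp] theorem inl_mem_cycleScope {c : OrientedCycle G} {x : V} :
    (Sum.inl x : Var G) ∈ cycleScope G c ↔ x ∈ c.1 := by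
  simp [cycleScope]

@[simp] theorem inr_mem_cycleScope {c d : OrientedCycle G} :
    (Sum.inr d : Var G) ∈ cycleScope G c ↔ d = c := by
  simp [cycleScope]

variable {w : V → V → ℝ} {α : OrientedCycle G → ℝ}

theorem not_sat_system_iff {c : OrientedCycle G} {a : ∀ i, Val G i} :
    ¬ (system G w α).Sat c a ↔ Contains a c ∧ bit a c = false := by
  simp only [system]
  cases bit a c <;> simp

theorem isExtremal_system : (system G w α).IsExtremal where
  not_sat_congr c a a' h hc := by
    rw [not_sat_system_iff] at hc ⊢
    refine ⟨hc.1.congr fun x hx => ?_, ?_⟩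
    · exact congrArg Subtype.val (h (.inl x) (inl_mem_cycleScope.2 hx))
    · rw [← hc.2]
      exact congrArg ULift.down (h (.inr c) (inr_mem_cycleScope.2 rfl)).symm
  eq_of_not_disjoint a c d hc hd h := by
    rw [not_sat_system_iff] at hc hd
    obtain ⟨x | e, hi, hi'⟩ := Finset.not_disjoint_iff.1 h
    · exact hc.1.eq_of_mem hd.1 (inl_mem_cycleScope.1 hi) (inl_mem_cycleScope.1 hi')
    · exact (inr_mem_cycleScope.1 hi).symm.trans (inr_mem_cycleScope.1 hi')

/-! ### Laws of the variables and a satisfying assignment of positive probability -/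

open Classical in
theorem sum_weight_pos [Nontrivial V] (hG : G.Connected)
    (hw : ∀ x y, G.Adj x y → 0 < w x y) (x : V) :
    0 < ∑ z ∈ Finset.univ.filter (G.Adj x), w x z := by
  obtain ⟨y, hy⟩ := hG.preconnected.exists_adj_of_nontrivial x
  exact Finset.sum_pos (fun z hz => hw x z (Finset.mem_filter.1 hz).2) ⟨y, by simpa using hy⟩

theorem stepProb_pos [Nontrivial V] (hG : G.Connected) (hw : ∀ x y, G.Adj x y → 0 < w x y)
    {x y : V} (h : G.Adj x y) : 0 < stepProb G w x y :=
  div_pos (hw x y h) (sum_weight_pos hG hw x)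

theorem isProb_system [Nontrivial V] [∀ i, Fintype (Val G i)] (hG : G.Connected)
    (hw : ∀ x y, G.Adj x y → 0 < w x y) (hα : ∀ c, 0 ≤ α c ∧ α c ≤ 1) :
    (system G w α).IsProb where
  nonneg := by
    rintro (x | c) v
    · exact (stepProb_pos hG hw v.2).le
    · change 0 ≤ if ULift.down v = true then α c else 1 - α c
      split_ifs
      · exact (hα c).1
      · exact sub_nonneg.2 (hα c).2
  sum_eq_one := by
    classical
    rintro (x | c)
    · have h : ∑ y ∈ Finset.univ.filter (G.Adj x), stepProb G w x y = 1 := by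
        simp only [stepProb, ← Finset.sum_div]
        exact div_self (sum_weight_pos hG hw x).ne'
      rw [← h]
      refine Finset.sum_bij (fun (v : G.neighborSet x) _ => v.1) ?_ ?_ ?_ ?_
      · exact fun v _ => by simpa using v.2
      · exact fun v _ v' _ => Subtype.ext
      · exact fun y hy => ⟨⟨y, (Finset.mem_filter.1 hy).2⟩, Finset.mem_univ _, rfl⟩
      · exact fun v _ => rfl
    · have h : ∑ b : Bool, (if b = true then α c else 1 - α c) = 1 := by simp
      rw [← h]
      let e : Val G (.inr c) ≃ Bool := Equiv.ulift
      exact Fintype.sum_equiv e _ _ fun v => rfl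

/-- Pointing the cycle `c` along itself, and all the other nodes towards it. -/
theorem exists_contains_unique (hG : G.Connected) (c : OrientedCycle G) :
    ∃ v : ∀ x, G.neighborSet x, c.1.Chain (fun x y => (v x).1 = y) ∧
      ∀ d : OrientedCycle G, d.1.Chain (fun x y => (v x).1 = y) → d = c := by
  classical
  obtain ⟨x₀, -, -, hx₀, -⟩ := c.2.1.2
  have : Nonempty V := ⟨x₀⟩
  obtain ⟨f, hf⟩ := c.2.1.1.exists_chain_apply
  have hfadj : ∀ x ∈ c.1, G.Adj x (f x) := fun x hx => c.2.2.rel_apply hf hx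
  have htoward : ∀ x ∉ c.1, ∃ y, G.Adj x y ∧ G.dist y x₀ < G.dist x x₀ := by
    intro x hx
    obtain ⟨p, hp⟩ := hG.exists_walk_length_eq_dist x x₀
    cases p with
    | nil => exact absurd hx₀ hx
    | cons h q =>
      refine ⟨_, h, ?_⟩
      rw [← hp, SimpleGraph.Walk.length_cons]
      exact Nat.lt_succ_of_le (SimpleGraph.dist_le q)
  choose g hgadj hg using htoward
  let v : ∀ x, G.neighborSet x := fun x =>
    if hx : x ∈ c.1 then ⟨f x, hfadj x hx⟩ else ⟨g x hx, hgadj x hx⟩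
  have hvc : c.1.Chain (fun x y => (v x).1 = y) := hf.imp_of_mem fun x hx y hxy => by
    simpa [v, hx] using hxy
  refine ⟨v, hvc, fun d hd => ?_⟩
  obtain ⟨z, -, -, hz, -⟩ := d.2.1.2
  -- The node of `d` nearest to `x₀` lies on `c`: otherwise its successor, also on `d`, would be
  -- nearer.
  obtain ⟨x, hx, hmin⟩ := Set.exists_min_image {x | x ∈ d.1} (fun x => G.dist x x₀)
    (Set.toFinite _) ⟨z, hz⟩
  have hxc : x ∈ c.1 := by
    by_contra hxc
    obtain ⟨y, hy, rfl⟩ := hd.exists_rel hx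
    have h1 := hmin _ hy
    have h2 := hg x hxc
    simp only [v, hxc, dif_neg, not_false_eq_true] at h1
    omega
  exact Subtype.ext (Cycle.eq_of_chain_apply d.2.1.1 c.2.1.1 hd hvc hx hxc)

theorem exists_formula_prodProb_pos [Nontrivial V] (hG : G.Connected)
    (hw : ∀ x y, G.Adj x y → 0 < w x y) (hα : ∀ c, 0 ≤ α c) (hα_pos : ∃ c, 0 < α c) :
    ∃ a, (system G w α).Formula a ∧ 0 < (system G w α).prodProb a := by
  classical
  obtain ⟨c, hc⟩ := hα_pos
  obtain ⟨v, -, hv⟩ := exists_contains_unique hG c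
  let a : ∀ i, Val G i := fun i => match i with
    | .inl x => v x
    -- This choice gives every bit positive probability, even when `α d` is 0 or 1, and accepts `c`,
    -- the only cycle present.
    | .inr d => ULift.up (decide (0 < α d))
  refine ⟨a, fun d => ?_, Finset.prod_pos ?_⟩
  · by_contra h
    obtain ⟨hd, hb⟩ := not_sat_system_iff.1 h
    obtain rfl := hv d hd
    exact absurd hc (of_decide_eq_false hb)
  · rintro (x | d) -
    · exact stepProb_pos hG hw (v x).2
    · change 0 < if decide (0 < α d) = true then α d else 1 - α d
      by_cases h : 0 < α d
      · simp [h]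
      · have : α d = 0 := le_antisymm (not_lt.1 h) (hα d)
        simp [this]

end CyclePopping
open CyclePopping in
theorem proposition5p16 {V : Type u} [Fintype V] [Nontrivial V]
    (G : SimpleGraph V) (hG : G.Connected)
    (w : V → V → ℝ) (hw_symm : ∀ x y, w x y = w y x) (hw_pos : ∀ x y, G.Adj x y → 0 < w x y)
    (α : OrientedCycle G → ℝ) (hα : ∀ c, 0 ≤ α c ∧ α c ≤ 1) (hα_pos : ∃ c, 0 < α c)
    (σ : OrientedCycle G → ℕ) (hσ : Function.Injective σ)
    {Ω : Type*} [MeasurableSpace Ω] (P : Measure Ω) [IsProbabilityMeasure P]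
    (E : ℕ → Ω → ∀ i, Val G i) (hE : (system G w α).IsPRSChain σ P E)
    (t : OrientedCycle G → ℝ) (ht : ∀ c, 0 < t c ∧ t c < 1) :
    -- the chain almost surely reaches an assignment that satisfies all the constraints
    (∀ᵐ ω ∂P, ∃ k, (system G w α).Formula (E k ω)) ∧
    -- joint law of the heap of resampled scopes and of the output
    (∀ (H : (system G w α).Heap) (a : ∀ i, Val G i), (system G w α).Formula a →
      P.real {ω | (system G w α).split σ (fun k => E k ω) = (H, a)} =
        H.weight * (system G w α).prodProb a) ∧
    -- generating function of the numbers of resamplings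
    Integrable (fun ω => ∏ c, t c ^ ((system G w α).split σ (fun k => E k ω)).1.count c) P ∧
    0 < ∑ T ∈ (system G w α).trivialHeaps,
      (-1 : ℝ) ^ T.card * (∏ π ∈ T, π.weight) * ∏ π ∈ T, t π.index ∧
    ∫ ω, ∏ c, t c ^ ((system G w α).split σ (fun k => E k ω)).1.count c ∂P =
      (∑ T ∈ (system G w α).trivialHeaps, (-1 : ℝ) ^ T.card * ∏ π ∈ T, π.weight) /
        ∑ T ∈ (system G w α).trivialHeaps,
          (-1 : ℝ) ^ T.card * (∏ π ∈ T, π.weight) * ∏ π ∈ T, t π.index := by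
  have := fun i => Fintype.ofFinite (Val G i)
  exact hE.law isExtremal_system (isProb_system hG hw_pos hα)
    (exists_formula_prodProb_pos hG hw_pos (fun c => (hα c).1) hα_pos) t ht
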